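/- Let $m\in\mathbb{N}$, let $\mathbf h(\theta)\in\mathbb{C}^m$ be given for every direction $\theta\in\mathbb{R}$, and put $\mathbf H(\theta)=\mathbf h(\theta)\mathbf h(\theta)^H$. Let $\theta_c\in\mathbb{R}$ (the client's direction), let $I\subseteq\mathbb{R}$ be any set (in the application, an interval of possible directions of an adversary), let $0<\gamma_a<\gamma_c$, $\sigma_n^2>0$ and $P\in\mathbb{R}$. For $\mathbf w\in\mathbb{C}^m$ and a Hermitian positive semidefinite $\mathbf\Sigma\in\mathbb{C}^{m\times m}$ write $$\mathrm{SINR}(\theta)=\frac{\mathbf w^H\mathbf H(\theta)\mathbf w}{\mathrm{Tr}(\mathbf H(\theta)\mathbf\Sigma)+\sigma_n^2}.$$ Consider the nonconvex problem $$\textbf{(P2)}:\quad \min_{\mathbf w\in\mathbb{C}^m,\ \mathbf\Sigma\succcurlyeq 0}\ \|\mathbf w\|^2+\mathrm{Tr}(\mathbf\Sigma)$$ subject to $\mathrm{SINR}(\theta_c)\ge\gamma_c$, $\mathrm{SINR}(\theta)\le\gamma_a$ for all $\theta\in I$, and $|\mathbf w(i)|^2+\mathbf\Sigma(i,i)\le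 P$ for all $i\in\{1,\dots,m\}$, and its semidefinite relaxation $$\textbf{(P3)}:\quad \min_{\mathbf W\succcurlyeq 0,\ \mathbf\Sigma\succcurlyeq 0}\ \mathrm{Tr}(\mathbf W)+\mathrm{Tr}(\mathbf\Sigma)$$ subject to $\mathrm{Tr}(\mathbf H(\theta_c)\mathbf W)\ge\gamma_c\mathrm{Tr}(\mathbf H(\theta_c)\mathbf\Sigma)+\gamma_c\sigma_n^2$, $\mathrm{Tr}(\mathbf H(\theta)\mathbf W)\le\gamma_a\mathrm{Tr}(\mathbf H(\theta)\mathbf\Sigma)+\gamma_a\sigma_n^2$ for all $\theta\in I$, and $\mathbf W(i,i)+\mathbf\Sigma(i,i)\le P$ for all $i\in\{1,\dots,m\}$, where $\mathbf W,\mathbf\Sigma\in\mathbb{C}^{m\times m}$ are Hermitian. Suppose that (P3) has a feasible point $(\underline{\mathbf W},\underline{\mathbf\Sigma})$ with $\mathrm{rank}(\underline{\mathbf W})=\mathrm{rank}(\underline{\mathbf\Sigma})=m$. Then every optimal solution $(\widetilde{\mathbf W},\widetilde{\mathbf\Sigma})$ of (P3) satisfies $\mathrm{rank}(\widetilde{\mathbf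 W})=1$; in particular $\widetilde{\mathbf W}=\widetilde{\mathbf w}\widetilde{\mathbf w}^H$ for some $\widetilde{\mathbf w}\in\mathbb{C}^m$, and for every such $\widetilde{\mathbf w}$ the pair $(\widetilde{\mathbf w},\widetilde{\mathbf\Sigma})$ is an optimal solution of (P2). Moreover the relaxation is exact: (P2) and (P3) have the same optimal value (infimum of the objective over the feasible set). -/

import Mathlib

open scoped ComplexOrder Matrix

noncomputable section

/-- The data of the transmission problem at one time step: `m` agents with narrowband channel
gains `channel θ i` towards a receiver in the direction `θ`, the client's direction, the set of
directions in which the signal must not be decodable at this time step, the SINR thresholds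
`γ_c` and `γ_a`, the noise variance `σ_n²` and the maximum power `P` of each agent. -/
structure BeamformingData (m : ℕ) where
  channel : ℝ → Fin m → ℂ
  clientDir : ℝ
  advDirs : Set ℝ
  gammaC : ℝ
  gammaA : ℝ
  noiseVar : ℝ
  power : ℝ

namespace BeamformingData

variable {m : ℕ} (D : BeamformingData m)

/-- The rank-one channel matrix `H(θ) = h(θ) h(θ)ᴴ`. -/
def channelMatrix (θ : ℝ) : Matrix (Fin m) (Fin m) ℂ :=
  Matrix.vecMulVec (D.channel θ) (star (D.channel θ))

/-- `SINR(θ) = wᴴ H(θ) w / (Tr(H(θ) Σ) + σ_n²)`. For positive semidefinite `S` both complex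
quantities are real, so taking real parts loses nothing. -/
def sinr (w : Fin m → ℂ) (S : Matrix (Fin m) (Fin m) ℂ) (θ : ℝ) : ℝ :=
  (star w ⬝ᵥ (D.channelMatrix θ *ᵥ w)).re / ((D.channelMatrix θ * S).trace.re + D.noiseVar)

/-- Feasible pairs `(w, Σ)` of the nonconvex problem P2. -/
structure P2Feasible (w : Fin m → ℂ) (S : Matrix (Fin m) (Fin m) ℂ) : Prop where
  psd : S.PosSemidef
  client : D.gammaC ≤ D.sinr w S D.clientDir
  adversary : ∀ θ ∈ D.advDirs, D.sinr w S θ ≤ D.gammaA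
  power_le : ∀ i, ‖w i‖ ^ 2 + (S i i).re ≤ D.power

/-- The objective `‖w‖² + Tr(Σ)` of P2, with the Euclidean norm of `w`. -/
def p2Objective (w : Fin m → ℂ) (S : Matrix (Fin m) (Fin m) ℂ) : ℝ :=
  (∑ i, ‖w i‖ ^ 2) + S.trace.re

/-- `(w, Σ)` is an optimal solution of P2. -/
def P2Optimal (w : Fin m → ℂ) (S : Matrix (Fin m) (Fin m) ℂ) : Prop :=
  D.P2Feasible w S ∧ ∀ w' S', D.P2Feasible w' S' → p2Objective w S ≤ p2Objective w' S'

/-- The optimal value of P2, as an infimum in the extended reals. -/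
def p2Value : EReal :=
  sInf {v : EReal | ∃ w S, D.P2Feasible w S ∧ v = (p2Objective w S : ℝ)}

/-- Feasible pairs `(W, Σ)` of the semidefinite relaxation P3. -/
structure P3Feasible (W S : Matrix (Fin m) (Fin m) ℂ) : Prop where
  psd_left : W.PosSemidef
  psd_right : S.PosSemidef
  client : D.gammaC * (D.channelMatrix D.clientDir * S).trace.re + D.gammaC * D.noiseVar ≤
    (D.channelMatrix D.clientDir * W).trace.re
  adversary : ∀ θ ∈ D.advDirs, (D.channelMatrix θ * W).trace.re ≤
    D.gammaA * (D.channelMatrix θ * S).trace.re + D.gammaA * D.noiseVar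
  power_le : ∀ i, (W i i).re + (S i i).re ≤ D.power

/-- The objective `Tr(W) + Tr(Σ)` of P3. -/
def p3Objective (W S : Matrix (Fin m) (Fin m) ℂ) : ℝ :=
  W.trace.re + S.trace.re

/-- `(W, Σ)` is an optimal solution of P3. -/
def P3Optimal (W S : Matrix (Fin m) (Fin m) ℂ) : Prop :=
  D.P3Feasible W S ∧ ∀ W' S', D.P3Feasible W' S' → p3Objective W S ≤ p3Objective W' S'

/-- The optimal value of P3, as an infimum in the extended reals. -/
def p3Value : EReal :=
  sInf {v : EReal | ∃ W S, D.P3Feasible W S ∧ v = (p3Objective W S : ℝ)}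

end BeamformingData

end

namespace Matrix

variable {n : Type*} [Fintype n]

/-! Let `h` be the client's channel and `(W, S)` feasible for P3. The client constraint forces `a =
hᴴ W h > 0`, so `V = a⁻¹ (W h)(W h)ᴴ` makes sense. It satisfies `V ≤ W` in the Loewner order and `hᴴ
V h = a`. The client's gain is thus unchanged, while adversary gains, diagonal entries and trace can
only decrease, so `(V, S)` is feasible at no greater cost (`P3Feasible.exists_rank_one_le`). At an
optimum `W - V` is positive semidefinite with trace zero, hence `W = V`. Rank-one points of P3
correspond to points of P2 (`p2Feasible_iff_p3Feasible`). -/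

/-- Deflating a positive semidefinite matrix along `h` leaves it positive semidefinite. -/
theorem PosSemidef.sub_smul_vecMulVec_mulVec [DecidableEq n] {W : Matrix n n ℂ}
    (hW : W.PosSemidef) {h : n → ℂ} {a : ℝ} (ha : a ≠ 0) (hah : star h ⬝ᵥ (W *ᵥ h) = (a : ℂ)) :
    (W - (a : ℂ)⁻¹ • vecMulVec (W *ᵥ h) (star (W *ᵥ h))).PosSemidef := by
  have haC : (a : ℂ) ≠ 0 := by exact_mod_cast ha
  have hleft : star h ᵥ* W = star (W *ᵥ h) := by
    rw [star_mulVec, hW.isHermitian.eq]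
  have hsymm : star (W *ᵥ h) ⬝ᵥ h = (a : ℂ) := by
    rw [← hleft, ← dotProduct_mulVec, hah]
  -- Congruence by the projection that kills `h` and has the `W`-orthogonal complement of `h` as its
  -- range.
  have key := hW.conjTranspose_mul_mul_same (1 - (a : ℂ)⁻¹ • vecMulVec h (star (W *ᵥ h)))
  convert key using 1
  rw [conjTranspose_sub, conjTranspose_smul, conjTranspose_one, conjTranspose_vecMulVec]
  have hstar : star ((a : ℂ)⁻¹) = (a : ℂ)⁻¹ := by simp
  rw [hstar, star_star, sub_mul, one_mul, Matrix.smul_mul, vecMulVec_mul, hleft, sub_mul, mul_sub,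
    mul_one, Matrix.smul_mul, Matrix.mul_smul, mul_vecMulVec, mul_sub, mul_one, Matrix.mul_smul,
    vecMulVec_mul_vecMulVec, hsymm,
    vecMulVec_smul, inv_smul_smul₀ haC, sub_self, smul_zero, sub_zero]

theorem trace_vecMulVec_star_mul (h : n → ℂ) (W : Matrix n n ℂ) :
    (vecMulVec h (star h) * W).trace = star h ⬝ᵥ (W *ᵥ h) := by
  rw [vecMulVec_mul, trace_vecMulVec, dotProduct_comm, ← dotProduct_mulVec]

theorem trace_vecMulVec_star_self_re (w : n → ℂ) :
    (vecMulVec w (star w)).trace.re = ∑ i, ‖w i‖ ^ 2 := by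
  simp [trace, vecMulVec_apply, Complex.mul_conj, Complex.normSq_eq_norm_sq, -Complex.ofReal_pow]

theorem vecMulVec_star_self_apply_re {n : Type*} (w : n → ℂ) (i : n) :
    (vecMulVec w (star w) i i).re = ‖w i‖ ^ 2 := by
  simp [vecMulVec_apply, Complex.mul_conj, Complex.normSq_eq_norm_sq, -Complex.ofReal_pow]

end Matrix

namespace BeamformingData

open Matrix

variable {m : ℕ} (D : BeamformingData m)

theorem trace_channelMatrix_mul_nonneg {S : Matrix (Fin m) (Fin m) ℂ} (hS : S.PosSemidef)
    (θ : ℝ) : 0 ≤ (D.channelMatrix θ * S).trace.re := by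
  rw [channelMatrix, trace_vecMulVec_star_mul]
  exact (Complex.le_def.mp (hS.dotProduct_mulVec_nonneg _)).1

theorem re_dotProduct_channelMatrix (w : Fin m → ℂ) (θ : ℝ) :
    (star w ⬝ᵥ (D.channelMatrix θ *ᵥ w)).re =
      (D.channelMatrix θ * vecMulVec w (star w)).trace.re := by
  rw [trace_mul_comm, trace_vecMulVec_star_mul]

/-- Positive noise keeps the SINR denominators positive, so the fractions can be cleared in both
directions. -/
theorem p2Feasible_iff_p3Feasible (hnoise : 0 < D.noiseVar) (w : Fin m → ℂ)
    (S : Matrix (Fin m) (Fin m) ℂ) :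
    D.P2Feasible w S ↔ D.P3Feasible (vecMulVec w (star w)) S := by
  have hden (hS : S.PosSemidef) (θ : ℝ) :
      0 < (D.channelMatrix θ * S).trace.re + D.noiseVar :=
    add_pos_of_nonneg_of_pos (D.trace_channelMatrix_mul_nonneg hS θ) hnoise
  constructor
  · rintro ⟨hS, hc, ha, hp⟩
    refine ⟨posSemidef_vecMulVec_self_star w, hS, ?_, fun θ hθ => ?_, fun i => ?_⟩
    · rwa [sinr, le_div_iff₀ (hden hS _), re_dotProduct_channelMatrix, mul_add] at hc
    · have := ha θ hθ
      rwa [sinr, div_le_iff₀ (hden hS _), re_dotProduct_channelMatrix, mul_add] at this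
    · rw [vecMulVec_star_self_apply_re]
      exact hp i
  · rintro ⟨-, hS, hc, ha, hp⟩
    refine ⟨hS, ?_, fun θ hθ => ?_, fun i => ?_⟩
    · rwa [sinr, le_div_iff₀ (hden hS _), re_dotProduct_channelMatrix, mul_add]
    · rw [sinr, div_le_iff₀ (hden hS _), re_dotProduct_channelMatrix, mul_add]
      exact ha θ hθ
    · rw [← vecMulVec_star_self_apply_re]
      exact hp i

theorem p2Objective_eq_p3Objective (w : Fin m → ℂ) (S : Matrix (Fin m) (Fin m) ℂ) :
    p2Objective w S = p3Objective (vecMulVec w (star w)) S := by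
  rw [p2Objective, p3Objective, trace_vecMulVec_star_self_re]

/-- The signal covariance of a feasible point of P3 dominates a nonzero rank-one matrix that has
the same gain towards the client. -/
theorem P3Feasible.exists_rank_one_le {D : BeamformingData m} (hnoise : 0 < D.noiseVar)
    (hgammaC : 0 < D.gammaC) {W S : Matrix (Fin m) (Fin m) ℂ} (hf : D.P3Feasible W S) :
    ∃ w : Fin m → ℂ, w ≠ 0 ∧ (W - vecMulVec w (star w)).PosSemidef ∧
      D.P3Feasible (vecMulVec w (star w)) S := by
  set h := D.channel D.clientDir with h_def
  set a := (D.channelMatrix D.clientDir * W).trace.re with a_def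
  have ha : 0 < a := lt_of_lt_of_le (add_pos_of_nonneg_of_pos
    (mul_nonneg hgammaC.le (D.trace_channelMatrix_mul_nonneg hf.psd_right _))
    (mul_pos hgammaC hnoise)) hf.client
  have hah : star h ⬝ᵥ (W *ᵥ h) = (a : ℂ) := by
    have h0 := Complex.le_def.mp (hf.psd_left.dotProduct_mulVec_nonneg h)
    rw [a_def, channelMatrix, trace_vecMulVec_star_mul]
    exact Complex.ext (by simp [h_def]) (by simpa using h0.2.symm)
  have haC : (a : ℂ) ≠ 0 := by exact_mod_cast ha.ne'
  -- The scaling makes `w wᴴ` equal to the matrix `a⁻¹ (W h)(W h)ᴴ` removed by deflation.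
  set w : Fin m → ℂ := ((Real.sqrt a)⁻¹ : ℂ) • (W *ᵥ h) with w_def
  have hsq : ((Real.sqrt a : ℂ))⁻¹ * ((Real.sqrt a : ℂ))⁻¹ = (a : ℂ)⁻¹ := by
    rw [← mul_inv, ← Complex.ofReal_mul, Real.mul_self_sqrt ha.le]
  have hww : vecMulVec w (star w) = (a : ℂ)⁻¹ • vecMulVec (W *ᵥ h) (star (W *ᵥ h)) := by
    rw [w_def, star_smul, smul_vecMulVec, vecMulVec_smul, smul_smul]
    simp [hsq]
  have hpsd : (W - vecMulVec w (star w)).PosSemidef := by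
    rw [hww]
    exact hf.psd_left.sub_smul_vecMulVec_mulVec ha.ne' hah
  have hgain (θ : ℝ) : (D.channelMatrix θ * vecMulVec w (star w)).trace.re ≤
      (D.channelMatrix θ * W).trace.re := by
    have := D.trace_channelMatrix_mul_nonneg hpsd θ
    rw [mul_sub, trace_sub, Complex.sub_re] at this
    linarith
  have hclient : (D.channelMatrix D.clientDir * vecMulVec w (star w)).trace.re = a := by
    have hleft : star h ᵥ* W = star (W *ᵥ h) := by
      rw [star_mulVec, hf.psd_left.isHermitian.eq]
    have hsymm : star (W *ᵥ h) ⬝ᵥ h = (a : ℂ) := by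
      rw [← hleft, ← dotProduct_mulVec, hah]
    rw [channelMatrix, trace_vecMulVec_star_mul, ← h_def, hww, smul_mulVec, vecMulVec_mulVec,
      hsymm, dotProduct_smul]
    simp [hah, haC]
  refine ⟨w, ?_, hpsd, posSemidef_vecMulVec_self_star w, hf.psd_right, ?_, fun θ hθ => ?_,
    fun i => ?_⟩
  -- A zero `w` would give the client zero gain, but the gain is `a > 0`.
  · intro hw
    rw [hw] at hclient
    simp at hclient
    exact ha.ne hclient
  · rw [hclient]
    exact hf.client
  · exact (hgain θ).trans (hf.adversary θ hθ)
  · have hi := (Complex.le_def.mp (hpsd.diag_nonneg (i := i))).1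
    rw [Matrix.sub_apply, Complex.sub_re, Complex.zero_re] at hi
    have := hf.power_le i
    linarith

theorem p3Objective_le_of_posSemidef_sub {V W : Matrix (Fin m) (Fin m) ℂ}
    (h : (W - V).PosSemidef) (S : Matrix (Fin m) (Fin m) ℂ) :
    p3Objective V S ≤ p3Objective W S := by
  have := (Complex.le_def.mp h.trace_nonneg).1
  rw [trace_sub, Complex.sub_re, Complex.zero_re] at this
  rw [p3Objective, p3Objective]
  linarith

theorem eq_of_posSemidef_sub_of_p3Objective_le {V W : Matrix (Fin m) (Fin m) ℂ}
    (h : (W - V).PosSemidef) {S : Matrix (Fin m) (Fin m) ℂ}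
    (hle : p3Objective W S ≤ p3Objective V S) : W = V := by
  have hn := Complex.le_def.mp h.trace_nonneg
  have h0 : (W - V).trace = 0 := by
    refine Complex.ext (le_antisymm ?_ hn.1) hn.2.symm
    rw [trace_sub, Complex.sub_re, Complex.zero_re]
    rw [p3Objective, p3Objective] at hle
    linarith
  exact sub_eq_zero.mp (h.trace_eq_zero_iff.mp h0)

theorem P3Optimal.exists_eq_vecMulVec {D : BeamformingData m} (hnoise : 0 < D.noiseVar)
    (hgammaC : 0 < D.gammaC) {W S : Matrix (Fin m) (Fin m) ℂ} (ho : D.P3Optimal W S) :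
    ∃ w : Fin m → ℂ, w ≠ 0 ∧ W = vecMulVec w (star w) := by
  obtain ⟨w, hw, hpsd, hf⟩ := ho.1.exists_rank_one_le hnoise hgammaC
  exact ⟨w, hw, eq_of_posSemidef_sub_of_p3Objective_le hpsd (ho.2 _ _ hf)⟩

theorem P3Optimal.p2Optimal {D : BeamformingData m} (hnoise : 0 < D.noiseVar)
    {w : Fin m → ℂ} {S : Matrix (Fin m) (Fin m) ℂ}
    (ho : D.P3Optimal (vecMulVec w (star w)) S) : D.P2Optimal w S := by
  refine ⟨(D.p2Feasible_iff_p3Feasible hnoise w S).mpr ho.1, fun w' S' hf => ?_⟩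
  rw [p2Objective_eq_p3Objective, p2Objective_eq_p3Objective]
  exact ho.2 _ _ ((D.p2Feasible_iff_p3Feasible hnoise w' S').mp hf)

/-- Deflation applies to every feasible point, so neither infimum needs to be attained. -/
theorem p2Value_eq_p3Value (hnoise : 0 < D.noiseVar) (hgammaC : 0 < D.gammaC) :
    D.p2Value = D.p3Value := by
  refine le_antisymm (le_sInf ?_) (le_sInf ?_)
  · rintro _ ⟨W, S, hf, rfl⟩
    obtain ⟨w, -, hpsd, hf'⟩ := hf.exists_rank_one_le hnoise hgammaC
    have hle : D.p2Value ≤ (p2Objective w S : ℝ) :=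
      sInf_le ⟨w, S, (D.p2Feasible_iff_p3Feasible hnoise w S).mpr hf', rfl⟩
    refine hle.trans ?_
    rw [p2Objective_eq_p3Objective]
    exact EReal.coe_le_coe_iff.mpr (p3Objective_le_of_posSemidef_sub hpsd S)
  · rintro _ ⟨w, S, hf, rfl⟩
    rw [p2Objective_eq_p3Objective]
    exact sInf_le ⟨_, S, (D.p2Feasible_iff_p3Feasible hnoise w S).mp hf, rfl⟩

end BeamformingData

theorem theorem1 {m : ℕ} (D : BeamformingData m)
    (hnoise : 0 < D.noiseVar) (hgammaA : 0 < D.gammaA) (hgamma : D.gammaA < D.gammaC)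
    (hfull : ∃ W S : Matrix (Fin m) (Fin m) ℂ, D.P3Feasible W S ∧ W.rank = m ∧ S.rank = m) :
    (∀ W S : Matrix (Fin m) (Fin m) ℂ, D.P3Optimal W S →
      W.rank = 1 ∧
      (∃ w : Fin m → ℂ, W = Matrix.vecMulVec w (star w)) ∧
      (∀ w : Fin m → ℂ, W = Matrix.vecMulVec w (star w) → D.P2Optimal w S)) ∧
    D.p2Value = D.p3Value := by
  have hgammaC : 0 < D.gammaC := hgammaA.trans hgamma
  refine ⟨fun W S ho => ?_, D.p2Value_eq_p3Value hnoise hgammaC⟩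
  obtain ⟨w, hw, hW⟩ := ho.exists_eq_vecMulVec hnoise hgammaC
  refine ⟨?_, ⟨w, hW⟩, ?_⟩
  · rw [hW]
    refine le_antisymm (Matrix.rank_vecMulVec_le _ _) (Nat.one_le_iff_ne_zero.mpr fun h0 => ?_)
    -- Rank zero would make `w wᴴ` vanish, contradicting `w ≠ 0`.
    rw [Matrix.rank, Submodule.finrank_eq_zero, LinearMap.range_eq_bot] at h0
    have h1 := congrArg LinearMap.toMatrix' h0
    rw [← Matrix.toLin'_apply', LinearMap.toMatrix'_toLin', map_zero,
      Matrix.vecMulVec_eq_zero] at h1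
    simp [hw] at h1
  · rintro v rfl
    exact ho.p2Optimal hnoise
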